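/- Let $P$ be a closed connected oriented smooth manifold of dimension $n$ and $M$ a connected oriented smooth manifold (without boundary) of dimension $m$. Let $\mathcal P=C^\infty(P,M)$ with the $C^\infty$-topology. **The space $\mathcal N$.** For $k\ge 1$ put $N_k=P_1\sqcup\dots\sqcup P_k$ ($k$ copies of $P$). A mark $\mathbf m$ on $N_k$ is a finite family $(q_\gamma)$ of $|\mathbf m|\ge 0$ points of $N_k$, repetitions allowed, together with a grading $g(\mathbf m)\in\{1,2,\dots\}$. Let $X_k$ be the space of all pairs $(\mathfrak M,f)$, where $\mathfrak M=(\mathbf m_1,\dots,\mathbf m_l)$, $l\ge 0$, is a finite sequence of marks on $N_k$ and $f:N_k\to M$ is a smooth map that is constant on each $\mathbf m_i$; it is topologized as the disjoint union, over $l$ and over all gradings and sizes of the marks, of subspaces of $N_k^{\sum|\mathbf m_i|}\times\mathcal P^k$. The symmetric group $S_k$ acts on $X_k$ by permuting the copies of $P$, and $$\mathcal N=M\sqcup\coprod_{k\ge1}X_k/S_k .$$ **Bordism of $\mathcal N$.** Singular manifolds in $X_k/S_k$ are taken together with their adjoint maps: a singular manifold $\varphi$ from a compact oriented smooth manifold $F$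 to $X_k/S_k$ means a principal $S_k$-bundle $Q\to F$ with a continuous $S_k$-equivariant map $\tilde\varphi:Q\to X_k$; equivalently, a compact oriented manifold $Q$ with a free smooth orientation-preserving $S_k$-action and such a $\tilde\varphi$, where $F=Q/S_k$. (In other words, $X_k/S_k$ is read as the homotopy quotient. When the bundle is trivial, $\tilde\varphi$ is a family of multimarked maps given by $F\times N_k\to M$, up to renumbering the copies of $P$.) Let $\Omega_j(X_k/S_k)$ be the corresponding oriented bordism group: classes of closed $j$-dimensional singular manifolds, with disjoint union as addition and boundaries of compact singular manifolds equal to $0$. Let $\Omega_j(M)$ be the usual oriented bordism group of $M$, and put $$\Omega_j(\mathcal N)=\Omega_j(M)\oplus\bigoplus_{k\ge1}\Omega_j(X_k/S_k),\qquad \mathbb O_i(\mathcal N)=\Omega_{i+m}(\mathcal N)\qquad (i,j\in\mathbb Z).$$ **The homomorphisms.** $\mathrm{lift}:\mathbb O_i(\mathcal N)\to\mathbb O_{i+n}(\mathcal N)$ sends the class of $\tilde\varphi:Q\to X_k$ to the class of $\tilde\psi:Q\times N_k\to X_k$ (diagonal $S_k$-action), where $\tilde\psi(q,y)$ is obtained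 from $\tilde\varphi(q)$ by raising all gradings by $1$ and adding the one-point mark $\{y\}$ of grading $1$; on $\Omega_*(M)$ it sends $[\varphi:F\to M]$ to $[\varphi\circ\mathrm{pr}_1:F\times P\to M]$. $\mathrm{proj}:\mathbb O_i(\mathcal N)\to\mathbb O_i(\mathcal N)$ is the identity on $\Omega_*(M)$ and is otherwise induced by the following change of marks: if $g(\mathbf m)\ne1$, the grading decreases by $1$; if $g(\mathbf m)=1$ and $|\mathbf m|>1$, the grading increases by $1$; if $g(\mathbf m)=1$ and $|\mathbf m|\le1$, the mark is erased. Let $$\Delta=\mathrm{lift}\circ\mathrm{proj}:\mathbb O_i(\mathcal N)\to\mathbb O_{i+n}(\mathcal N).$$ **Claim.** If $P$ is the oriented boundary of a compact oriented manifold, then $\Delta^2=0$, that is, $\Delta\circ\Delta:\mathbb O_i(\mathcal N)\to\mathbb O_{i+2n}(\mathcal N)$ is zero for every $i\in\mathbb Z$. -/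

import Mathlib

open scoped Manifold ContDiff Topology

noncomputable section

namespace Garland

/-! ### Oriented smooth manifolds -/

/-- A smooth (Hausdorff, second countable) oriented `d`-dimensional manifold, possibly with
boundary.  It is modelled on the half space `{v | 0 ≤ ℓ v}` of a `d`-dimensional real vector
space `E`, where `ℓ` is the linear functional `lin`; there is no boundary when `ℓ = 0`.

The tangent space at `x` is identified with `E` by means of the preferred chart at `x`.  The
orientation at `x` is `sign x` times the orientation of the reference basis `basis` of `E`; the
last field says that the orientations fit together continuously. -/
structure OrMfd (d : ℕ) where
  E : Type
  H : Type
  carrier : Type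
  [normE : NormedAddCommGroup E]
  [spaceE : NormedSpace ℝ E]
  [topH : TopologicalSpace H]
  [top : TopologicalSpace carrier]
  [charted : ChartedSpace H carrier]
  [t2 : T2Space carrier]
  [sc : SecondCountableTopology carrier]
  I : ModelWithCorners ℝ E H
  [mfd : IsManifold I ∞ carrier]
  lin : E →L[ℝ] ℝ
  range_I : Set.range I = {v | 0 ≤ lin v}
  basis : Module.Basis (Fin d) ℝ E
  sign : carrier → ℤˣ
  sign_consistent : ∀ x, ∀ᶠ y in 𝓝 x,
    0 < ((sign x * sign y : ℤˣ) : ℝ) *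
      LinearMap.det (tangentCoordChange I y x y : E →ₗ[ℝ] E)

namespace OrMfd

instance (d : ℕ) : CoeSort (OrMfd d) Type := ⟨OrMfd.carrier⟩

attribute [instance] normE spaceE topH top charted t2 sc mfd

variable {d n e : ℕ}

/-- The manifold has no boundary. -/
def NoBoundary (F : OrMfd d) : Prop := F.lin = 0

/-- The differential of a map, as a map of the model vector spaces. -/
def deriv (F : OrMfd d) (F' : OrMfd e) (f : F → F') (x : F) : F.E →L[ℝ] F'.E :=
  mfderiv F.I F'.I f x

/-- `f` preserves orientations.  (In particular its differentials are isomorphisms.) -/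
def Preserves (F F' : OrMfd d) (f : F → F') : Prop :=
  ∀ x, 0 < ((F.sign x * F'.sign (f x) : ℤˣ) : ℝ) *
    F'.basis.det (fun i => F.deriv F' f x (F.basis i))

/-- `ι` identifies the oriented manifold `F` with the oriented boundary of `W`: it is a smooth
injective immersion onto the boundary, and an outward normal vector followed by the image of a
positive frame of `F` is a positive frame of `W`. -/
structure IsBoundaryMap (F : OrMfd d) (W : OrMfd (d + 1)) (ι : F → W) : Prop where
  smooth : ContMDiff F.I W.I ∞ ι
  injective : Function.Injective ι
  range_eq : Set.range ι = W.I.boundary W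
  oriented : ∀ x, ∀ ν : W.E, W.lin ν < 0 →
    0 < ((F.sign x * W.sign (ι x) : ℤˣ) : ℝ) *
      W.basis.det (Fin.cons ν (fun i => F.deriv W ι x (F.basis i)) : Fin (d + 1) → W.E)

/-- `F` is the oriented boundary of a compact oriented manifold. -/
def Bounds (F : OrMfd d) : Prop :=
  ∃ W : OrMfd (d + 1), CompactSpace W ∧ ∃ ι : F → W, F.IsBoundaryMap W ι

theorem range_of_noBoundary {F : OrMfd d} (h : F.NoBoundary) : Set.range F.I = Set.univ := by
  rw [F.range_I, h]; ext; simp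

theorem boundaryless {F : OrMfd d} (h : F.NoBoundary) : F.I.Boundaryless :=
  ⟨range_of_noBoundary h⟩

section linear_algebra

variable {E E' F F' : Type*} [AddCommGroup E] [AddCommGroup E'] [AddCommGroup F] [AddCommGroup F']
  [Module ℝ E] [Module ℝ E'] [Module ℝ F] [Module ℝ F']

/-- The concatenation of two bases, indexed by `Fin e` with `e = d + n`. -/
def prodBasis (h : e = d + n) (b : Module.Basis (Fin d) ℝ E) (b' : Module.Basis (Fin n) ℝ F) :
    Module.Basis (Fin e) ℝ (E × F) :=
  (b.prod b').reindex (finSumFinEquiv.trans (finCongr h.symm))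

theorem det_prodBasis (h : e = d + n) (b : Module.Basis (Fin d) ℝ E)
    (b' : Module.Basis (Fin n) ℝ F) (c : Module.Basis (Fin d) ℝ E')
    (c' : Module.Basis (Fin n) ℝ F') (L : E →ₗ[ℝ] E') (L' : F →ₗ[ℝ] F') :
    (prodBasis h c c').det (fun i => L.prodMap L' (prodBasis h b b' i)) =
      c.det (fun i => L (b i)) * c'.det (fun i => L' (b' i)) := by
  rw [prodBasis, Module.Basis.det_reindex, Module.Basis.det_apply, Module.Basis.det_apply,
    Module.Basis.det_apply, ← Matrix.det_fromBlocks_zero₂₁ _ 0]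
  congr 1
  ext i j
  rcases i with i | i <;> rcases j with j | j <;>
    simp [prodBasis, Module.Basis.toMatrix_apply]

theorem det_prodBasis_cons (h : e = d + n) (b : Module.Basis (Fin d) ℝ E)
    (b' : Module.Basis (Fin n) ℝ F) (c : Module.Basis (Fin (d + 1)) ℝ E')
    (h' : e + 1 = (d + 1) + n) (ν : E' × F) (L : E →ₗ[ℝ] E') :
    (prodBasis h' c b').det
        (Fin.cons ν (fun i => L.prodMap LinearMap.id (prodBasis h b b' i)) :
          Fin (e + 1) → E' × F) =
      c.det (Fin.cons ν.1 (fun i => L (b i)) : Fin (d + 1) → E') := by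
  have key : ∀ (i : Fin (d + 1) ⊕ Fin n),
      (Fin.cons ν (fun i => L.prodMap LinearMap.id (prodBasis h b b' i)) : Fin (e + 1) → E' × F)
        (finSumFinEquiv.trans (finCongr h'.symm) i) =
      Sum.elim (Fin.cons ν (fun i => (L (b i), 0)) : Fin (d + 1) → E' × F)
        (fun j => (0, b' j)) i := by
    subst h
    rintro (i | j)
    · refine Fin.cases ?_ (fun i => ?_) i
      · have : (finSumFinEquiv.trans (finCongr h'.symm) (Sum.inl (0 : Fin (d + 1)))) =
            (0 : Fin (d + n + 1)) := by ext; simp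
        rw [this]; simp
      · have : (finSumFinEquiv.trans (finCongr h'.symm) (Sum.inl i.succ)) =
            (Fin.castAdd n i).succ := by ext; simp
        rw [this]; simp [prodBasis]
    · have : (finSumFinEquiv.trans (finCongr h'.symm) (Sum.inr j)) =
            (Fin.natAdd d j).succ := by ext; simp; omega
      rw [this]; simp [prodBasis]
  rw [prodBasis, Module.Basis.det_reindex]
  have : (Fin.cons ν (fun i => L.prodMap LinearMap.id (prodBasis h b b' i)) :
      Fin (e + 1) → E' × F) ∘ (finSumFinEquiv.trans (finCongr h'.symm)) = _ := funext key
  rw [this, Module.Basis.det_apply, Module.Basis.det_apply]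
  have hM : (c.prod b').toMatrix (Sum.elim
      (Fin.cons ν (fun i => (L (b i), 0)) : Fin (d + 1) → E' × F) (fun j => (0, b' j))) =
      Matrix.fromBlocks (c.toMatrix (Fin.cons ν.1 (fun i => L (b i)) : Fin (d + 1) → E')) 0
        (Matrix.of fun i j =>
          b'.repr ((Fin.cons ν (fun i => (L (b i), 0)) : Fin (d + 1) → E' × F) j).2 i) 1 := by
    ext i j
    rcases i with i | i <;> rcases j with j | j
    · refine Fin.cases ?_ (fun j => ?_) j <;> simp [Module.Basis.toMatrix_apply]
    · simp [Module.Basis.toMatrix_apply]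
    · simp [Module.Basis.toMatrix_apply]
    · simp [Module.Basis.toMatrix_apply, Matrix.one_apply, Finsupp.single_apply, eq_comm]
  rw [hM, Matrix.det_fromBlocks_zero₁₂, Matrix.det_one, mul_one]

end linear_algebra

section product_charts

variable {E E' H H' M M' : Type*} [NormedAddCommGroup E] [NormedSpace ℝ E]
  [NormedAddCommGroup E'] [NormedSpace ℝ E'] [TopologicalSpace H] [TopologicalSpace H']
  {I : ModelWithCorners ℝ E H} {I' : ModelWithCorners ℝ E' H'}
  [TopologicalSpace M] [TopologicalSpace M'] [ChartedSpace H M] [ChartedSpace H' M']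
  [IsManifold I 1 M] [IsManifold I' 1 M']

theorem tangentCoordChange_prod (y x : M × M') (h₁ : y.1 ∈ (extChartAt I x.1).source)
    (h₂ : y.2 ∈ (extChartAt I' x.2).source) :
    tangentCoordChange (I.prod I') y x y =
      (tangentCoordChange I y.1 x.1 y.1).prodMap (tangentCoordChange I' y.2 x.2 y.2) := by
  have t₁ := hasFDerivWithinAt_tangentCoordChange (I := I) (x := y.1) (y := x.1) (z := y.1)
    ⟨mem_extChartAt_source y.1, h₁⟩
  have t₂ := hasFDerivWithinAt_tangentCoordChange (I := I') (x := y.2) (y := x.2) (z := y.2)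
    ⟨mem_extChartAt_source y.2, h₂⟩
  have t₃ := hasFDerivWithinAt_tangentCoordChange (I := I.prod I') (x := y) (y := x) (z := y)
    ⟨mem_extChartAt_source y, by rw [extChartAt_prod]; exact ⟨h₁, h₂⟩⟩
  have t₄ := HasFDerivWithinAt.prodMap (p := (extChartAt I y.1 y.1, extChartAt I' y.2 y.2))
    (s := Set.range I ×ˢ Set.range I')
    (t₁.mono (by rintro _ ⟨z, hz, rfl⟩; exact hz.1))
    (t₂.mono (by rintro _ ⟨z, hz, rfl⟩; exact hz.2))
  have hu : UniqueDiffWithinAt ℝ (Set.range (I.prod I')) (extChartAt (I.prod I') y y) :=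
    (I.prod I').uniqueDiffOn _ (Set.mem_range_self _)
  refine hu.eq t₃ ?_
  rw [ModelWithCorners.range_prod, extChartAt_prod, extChartAt_prod]
  exact t₄

end product_charts

/-- The product of an oriented manifold with an oriented manifold without boundary. -/
def prod (F : OrMfd d) (N : OrMfd n) (hN : N.NoBoundary) (h : e = d + n) : OrMfd e where
  E := F.E × N.E
  H := ModelProd F.H N.H
  carrier := F × N
  I := F.I.prod N.I
  lin := F.lin.comp (ContinuousLinearMap.fst ℝ F.E N.E)
  range_I := by
    rw [ModelWithCorners.range_prod, F.range_I, range_of_noBoundary hN]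
    ext; simp
  basis := prodBasis h F.basis N.basis
  sign x := F.sign x.1 * N.sign x.2
  sign_consistent x := by
    have h₁ := F.sign_consistent x.1
    have h₂ := N.sign_consistent x.2
    have h₃ : ∀ᶠ y in 𝓝 x.1, y ∈ (extChartAt F.I x.1).source := extChartAt_source_mem_nhds x.1
    have h₄ : ∀ᶠ y in 𝓝 x.2, y ∈ (extChartAt N.I x.2).source := extChartAt_source_mem_nhds x.2
    have hh := (h₁.and h₃).prod_nhds (h₂.and h₄)
    filter_upwards [hh] with y hy
    obtain ⟨⟨p₁, q₁⟩, p₂, q₂⟩ := hy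
    have hd : tangentCoordChange (F.I.prod N.I) y x y =
        (tangentCoordChange F.I y.1 x.1 y.1).prodMap (tangentCoordChange N.I y.2 x.2 y.2) :=
      tangentCoordChange_prod y x q₁ q₂
    rw [hd]
    have hdet : LinearMap.det (((tangentCoordChange F.I y.1 x.1 y.1).prodMap
        (tangentCoordChange N.I y.2 x.2 y.2) : F.E × N.E →L[ℝ] F.E × N.E) :
          F.E × N.E →ₗ[ℝ] F.E × N.E) =
        LinearMap.det (tangentCoordChange F.I y.1 x.1 y.1 : F.E →ₗ[ℝ] F.E) *
        LinearMap.det (tangentCoordChange N.I y.2 x.2 y.2 : N.E →ₗ[ℝ] N.E) := by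
      have := Module.Finite.of_basis F.basis
      have := Module.Finite.of_basis N.basis
      exact LinearMap.det_prodMap _ _
    rw [hdet]
    have := mul_pos p₁ p₂
    push_cast at this ⊢
    linarith



theorem deriv_prodMap {d' n' e' : ℕ} {F : OrMfd d} {F' : OrMfd d'} {N : OrMfd n} {N' : OrMfd n'}
    (hN : N.NoBoundary) (hN' : N'.NoBoundary) (h : e = d + n) (h' : e' = d' + n')
    (f : F → F') (k : N → N') (hf : ContMDiff F.I F'.I ∞ f) (hk : ContMDiff N.I N'.I ∞ k)
    (x : F × N) :
    (F.prod N hN h).deriv (F'.prod N' hN' h') (Prod.map f k) x =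
      (F.deriv F' f x.1).prodMap (N.deriv N' k x.2) :=
  mfderiv_prodMap ((hf x.1).mdifferentiableAt (by simp)) ((hk x.2).mdifferentiableAt (by simp))

theorem Preserves.prodMap {F F' : OrMfd d} {N N' : OrMfd n}
    (hN : N.NoBoundary) (hN' : N'.NoBoundary) (h : e = d + n)
    {f : F → F'} {k : N → N'} (hf : ContMDiff F.I F'.I ∞ f) (hk : ContMDiff N.I N'.I ∞ k)
    (pf : F.Preserves F' f) (pk : N.Preserves N' k) :
    (F.prod N hN h).Preserves (F'.prod N' hN' h) (Prod.map f k) := by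
  intro x
  have key := det_prodBasis h F.basis N.basis F'.basis N'.basis (F.deriv F' f x.1).toLinearMap
    (N.deriv N' k x.2).toLinearMap
  have hd := deriv_prodMap hN hN' h h f k hf hk x
  have := mul_pos (pf x.1) (pk x.2)
  unfold Preserves at *
  erw [hd]
  change 0 < (((F.sign x.1 * N.sign x.2) * (F'.sign (f x.1) * N'.sign (k x.2)) : ℤˣ) : ℝ) *
    (prodBasis h F'.basis N'.basis).det
      (fun i => ((F.deriv F' f x.1).toLinearMap.prodMap (N.deriv N' k x.2).toLinearMap)
        (prodBasis h F.basis N.basis i))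
  rw [key]
  have hs : F.sign x.1 * N.sign x.2 * (F'.sign (f x.1) * N'.sign (k x.2)) =
      F.sign x.1 * F'.sign (f x.1) * (N.sign x.2 * N'.sign (k x.2)) := mul_mul_mul_comm _ _ _ _
  rw [hs]
  simp only [ContinuousLinearMap.coe_coe, Units.val_mul (F.sign x.1 * F'.sign (f x.1)),
    Int.cast_mul ((F.sign x.1 * F'.sign (f x.1) : ℤˣ) : ℤ)]
  rw [mul_mul_mul_comm]
  exact this

theorem preserves_id (F : OrMfd d) : F.Preserves F id := by
  intro x
  have : F.deriv F id x = ContinuousLinearMap.id ℝ F.E := mfderiv_id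
  simp only [this, id, ContinuousLinearMap.id_apply]
  rw [Module.Basis.det_self]
  simp

theorem IsBoundaryMap.prod {F : OrMfd d} {W : OrMfd (d + 1)} {ι : F → W}
    (hι : F.IsBoundaryMap W ι) (N : OrMfd n) (hN : N.NoBoundary) (h : e = d + n)
    (h' : e + 1 = (d + 1) + n) :
    (F.prod N hN h).IsBoundaryMap (W.prod N hN h') (Prod.map ι id) where
  smooth := hι.smooth.prodMap contMDiff_id
  injective := hι.injective.prodMap Function.injective_id
  range_eq := by
    have := boundaryless hN
    change _ = (W.I.prod N.I).boundary (W × N)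
    rw [ModelWithCorners.boundary_of_boundaryless_right, ← hι.range_eq]
    exact Set.range_prodMap.trans (congrArg _ Set.range_id)
  oriented x ν hν := by
    have hd := deriv_prodMap hN hN h h' ι id hι.smooth contMDiff_id x
    have hid : N.deriv N id x.2 = ContinuousLinearMap.id ℝ N.E := mfderiv_id
    erw [hd, hid]
    have key := det_prodBasis_cons h F.basis N.basis W.basis h' ν (F.deriv W ι x.1).toLinearMap
    change 0 < (((F.sign x.1 * N.sign x.2) * (W.sign (ι x.1) * N.sign x.2) : ℤˣ) : ℝ) *
      (prodBasis h' W.basis N.basis).det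
        (Fin.cons ν (fun i => ((F.deriv W ι x.1).toLinearMap.prodMap LinearMap.id)
          (prodBasis h F.basis N.basis i)) : Fin (e + 1) → W.E × N.E)
    rw [key]
    have := hι.oriented x.1 ν.1 hν
    have hs : F.sign x.1 * N.sign x.2 * (W.sign (ι x.1) * N.sign x.2) =
        F.sign x.1 * W.sign (ι x.1) := by
      rw [mul_mul_mul_comm, Int.units_mul_self, mul_one]
    rw [hs]
    exact this

attribute [local instance] ChartedSpace.ofDiscreteTopology in
/-- The `0`-dimensional manifold of `k` positive points. -/
def points (k : ℕ) : OrMfd 0 where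
  E := PUnit
  H := PUnit
  carrier := Fin k
  charted := ChartedSpace.ofDiscreteTopology
  I := 𝓘(ℝ, PUnit)
  mfd := IsManifold.of_discreteTopology _
  lin := 0
  range_I := by ext; simp
  basis := Module.Basis.empty _
  sign _ := 1
  sign_consistent x := Filter.Eventually.of_forall fun y => by
    rw [LinearMap.det_eq_one_of_subsingleton]; simp

theorem points_noBoundary (k : ℕ) : (points k).NoBoundary := rfl

/-- The disjoint union `P₁ ⊔ ⋯ ⊔ P_k` of `k` copies of `P`; the point `(j, p)` is the point `p` of
the `j`-th copy. -/
def copies {n : ℕ} (k : ℕ) (P : OrMfd n) (hP : P.NoBoundary) : OrMfd n :=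
  (points k).prod P hP (zero_add n).symm

theorem prod_noBoundary {F : OrMfd d} (hF : F.NoBoundary) {N : OrMfd n} (hN : N.NoBoundary)
    (h : e = d + n) : (F.prod N hN h).NoBoundary := by
  change F.lin.comp (ContinuousLinearMap.fst ℝ F.E N.E) = 0
  rw [show F.lin = 0 from hF, ContinuousLinearMap.zero_comp]

theorem points_smooth {k : ℕ} (f : points k → points k) :
    ContMDiff (points k).I (points k).I ∞ f := by
  have : DiscreteTopology (points k) := inferInstanceAs (DiscreteTopology (Fin k))
  exact contMDiff_of_discreteTopology

theorem points_preserves {k : ℕ} (f : points k → points k) :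
    (points k).Preserves (points k) f := by
  intro x
  rw [Module.Basis.det_apply, Matrix.det_isEmpty]
  simp [points]

end OrMfd

/-! ### Equivariant oriented bordism -/

/-- A compact oriented manifold with a smooth orientation preserving action of the discrete
group `G`. -/
structure GMfd (G : Type) [Group G] (d : ℕ) extends OrMfd d where
  compact : CompactSpace carrier
  act : G →* Equiv.Perm carrier
  smooth : ∀ g, ContMDiff I I ∞ (act g)
  preserves : ∀ g, toOrMfd.Preserves toOrMfd (act g)

/-- A singular manifold `F → X / G` together with its adjoint (the action of `G` on `X` is `ρ`):
a compact oriented manifold `Q` with a free smooth orientation preserving action of the finite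
group `G` and a continuous equivariant map `Q → X`.  The singular manifold is `F = Q / G → X / G`,
and `Q` is the principal `G`-bundle over `F` on which the map lifts to `X`.  If `Q = F × G`, this
is just a map `F → X`, defined up to the action of `G`; if `G` acts freely and properly
discontinuously on `X`, every map `F → X / G` arises from exactly one `Q`.  For a space `X` of
multimarked maps `N → M` and `G` a group of permutations of the components of `N`, the map `Q → X`
is the adjoint family of multimarked maps `Q × N → M`. -/
structure SingMfd {G : Type} [Group G] {X : Type} [TopologicalSpace X] (ρ : G →* Equiv.Perm X)
    (d : ℕ) extends GMfd G d where
  free : ∀ g x, act g x = x → g = 1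
  map : carrier → X
  continuous_map : Continuous map
  equivariant : ∀ g x, map (act g x) = ρ g (map x)

section bordism

variable {G : Type} [Group G] {X Y : Type} [TopologicalSpace X] [TopologicalSpace Y]
  {ρ : G →* Equiv.Perm X} {ρ' : G →* Equiv.Perm Y} {d n e : ℕ}

namespace SingMfd

/-- `F` is the oriented boundary of `W`, as singular manifolds. -/
def IsBoundaryOf (F : SingMfd ρ d) (W : SingMfd ρ (d + 1)) : Prop :=
  ∃ ι : F.carrier → W.carrier, F.toOrMfd.IsBoundaryMap W.toOrMfd ι ∧
    (∀ g x, ι (F.act g x) = W.act g (ι x)) ∧ ∀ x, W.map (ι x) = F.map x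

/-- `i` is an orientation preserving open embedding of singular manifolds. -/
structure IsPiece (F₁ F : SingMfd ρ d) (i : F₁.carrier → F.carrier) : Prop where
  smooth : ContMDiff F₁.I F.I ∞ i
  injective : Function.Injective i
  preserves : F₁.toOrMfd.Preserves F.toOrMfd i
  equivariant : ∀ g x, i (F₁.act g x) = F.act g (i x)
  map_eq : ∀ x, F.map (i x) = F₁.map x

/-- `F` is the disjoint union of `F₁` and `F₂`. -/
def IsDisjointUnion (F F₁ F₂ : SingMfd ρ d) : Prop :=
  ∃ i₁ i₂, IsPiece F₁ F i₁ ∧ IsPiece F₂ F i₂ ∧ IsCompl (Set.range i₁) (Set.range i₂)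

/-- The composition of a singular manifold with an equivariant map. -/
def push (F : SingMfd ρ d) (f : X → Y) (hf : Continuous f) (he : ∀ g x, f (ρ g x) = ρ' g (f x)) :
    SingMfd ρ' d where
  toGMfd := F.toGMfd
  free := F.free
  map := f ∘ F.map
  continuous_map := hf.comp F.continuous_map
  equivariant g x := by simp [F.equivariant, he]

/-- The product of a singular manifold `F → X` with a closed `G`-manifold `N`, mapped by
`(x, y) ↦ f (φ x, y)` where `φ : F → X` is the given map. -/
def cross (F : SingMfd ρ d) (N : GMfd G n) (hN : N.NoBoundary) (h : e = d + n)
    (f : X × N.carrier → Y) (hf : Continuous f)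
    (he : ∀ g x y, f (ρ g x, N.act g y) = ρ' g (f (x, y))) : SingMfd ρ' e where
  toOrMfd := F.toOrMfd.prod N.toOrMfd hN h
  compact := by
    have := F.compact
    have := N.compact
    exact inferInstanceAs (CompactSpace (F.carrier × N.carrier))
  act :=
    { toFun := fun g => (F.act g).prodCongr (N.act g)
      map_one' := by rw [map_one, map_one]; rfl
      map_mul' := fun g g' => by rw [map_mul, map_mul]; rfl }
  smooth g := (F.smooth g).prodMap (N.smooth g)
  preserves g := OrMfd.Preserves.prodMap hN hN h (F.smooth g) (N.smooth g) (F.preserves g)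
    (N.preserves g)
  free g x hx := F.free g x.1 (congrArg Prod.fst hx)
  map x := f (F.map x.1, x.2)
  continuous_map := hf.comp ((F.continuous_map.comp continuous_fst).prodMk continuous_snd)
  equivariant g x := by
    change f (F.map (F.act g x.1), N.act g x.2) = _
    rw [F.equivariant, he]

end SingMfd

variable (ρ) in
/-- Closed singular manifolds of dimension `j`. -/
structure ClosedSingMfd (j : ℤ) where
  dim : ℕ
  dim_eq : (dim : ℤ) = j
  sing : SingMfd ρ dim
  closed : sing.NoBoundary

variable (ρ) in
/-- The relations of the bordism group: boundaries vanish, and disjoint unions are sums. -/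
inductive BordismRel (j : ℤ) : FreeAbelianGroup (ClosedSingMfd ρ j) → Prop
  | boundary (d : ℕ) (hd : (d : ℤ) = j) (F : SingMfd ρ d) (hF : F.NoBoundary)
      (W : SingMfd ρ (d + 1)) (h : F.IsBoundaryOf W) :
      BordismRel j (.of ⟨d, hd, F, hF⟩)
  | union (d : ℕ) (hd : (d : ℤ) = j) (F F₁ F₂ : SingMfd ρ d) (hF : F.NoBoundary)
      (hF₁ : F₁.NoBoundary) (hF₂ : F₂.NoBoundary) (h : F.IsDisjointUnion F₁ F₂) :
      BordismRel j (.of ⟨d, hd, F, hF⟩ - (.of ⟨d, hd, F₁, hF₁⟩ + .of ⟨d, hd, F₂, hF₂⟩))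

variable (ρ) in
/-- The oriented bordism group `Ω_j` of the quotient of the `G`-space `X` by `G`, presented by
generators and relations: bordism classes of closed singular manifolds, where addition is
disjoint union and boundaries vanish.  It is trivial for negative `j`.  If `G` is trivial, it is
the usual oriented bordism group `Ω_j(X)`. -/
def Bordism (j : ℤ) : Type 1 :=
  FreeAbelianGroup (ClosedSingMfd ρ j) ⧸ AddSubgroup.closure {x | BordismRel ρ j x}

instance (j : ℤ) : AddCommGroup (Bordism ρ j) :=
  inferInstanceAs (AddCommGroup (FreeAbelianGroup (ClosedSingMfd ρ j) ⧸ _))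

/-- The bordism class of a closed singular manifold. -/
def Bordism.mk {j : ℤ} (F : ClosedSingMfd ρ j) : Bordism ρ j :=
  QuotientAddGroup.mk (.of F)

/-- A function on closed singular manifolds that respects the relations defines a homomorphism. -/
def Bordism.hom {j : ℤ} {A : Type*} [AddCommGroup A] (f : ClosedSingMfd ρ j → A)
    (hf : ∀ x, BordismRel ρ j x → FreeAbelianGroup.lift f x = 0) : Bordism ρ j →+ A :=
  QuotientAddGroup.lift _ (FreeAbelianGroup.lift f) ((AddSubgroup.closure_le _).2 hf)

theorem Bordism.mk_boundary {j : ℤ} (d : ℕ) (hd : (d : ℤ) = j) (F : SingMfd ρ d)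
    (hF : F.NoBoundary) (W : SingMfd ρ (d + 1)) (h : F.IsBoundaryOf W) :
    Bordism.mk ⟨d, hd, F, hF⟩ = 0 :=
  (QuotientAddGroup.eq_zero_iff _).2
    (AddSubgroup.subset_closure (BordismRel.boundary d hd F hF W h))

theorem Bordism.mk_union {j : ℤ} (d : ℕ) (hd : (d : ℤ) = j) (F F₁ F₂ : SingMfd ρ d)
    (hF : F.NoBoundary) (hF₁ : F₁.NoBoundary) (hF₂ : F₂.NoBoundary)
    (h : F.IsDisjointUnion F₁ F₂) :
    Bordism.mk ⟨d, hd, F, hF⟩ = Bordism.mk ⟨d, hd, F₁, hF₁⟩ + Bordism.mk ⟨d, hd, F₂, hF₂⟩ :=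
  sub_eq_zero.1 ((QuotientAddGroup.eq_zero_iff _).2
    (AddSubgroup.subset_closure (BordismRel.union d hd F F₁ F₂ hF hF₁ hF₂ h)))

/-- The homomorphism induced by a continuous equivariant map. -/
def Bordism.push (f : X → Y) (hf : Continuous f) (he : ∀ g x, f (ρ g x) = ρ' g (f x)) (j : ℤ) :
    Bordism ρ j →+ Bordism ρ' j :=
  Bordism.hom (fun F => Bordism.mk ⟨F.dim, F.dim_eq, F.sing.push f hf he, F.closed⟩) (by
    rintro _ (⟨d, hd, F, hF, W, ι, h₁, h₂, h₃⟩ | ⟨d, hd, F, F₁, F₂, hF, hF₁, hF₂, i₁, i₂, h₁, h₂, h₃⟩)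
    · rw [FreeAbelianGroup.lift_apply_of]
      exact mk_boundary d hd (F.push f hf he) hF (W.push f hf he) ⟨ι, h₁, h₂, fun x => congrArg f (h₃ x)⟩
    · rw [map_sub, map_add, FreeAbelianGroup.lift_apply_of, FreeAbelianGroup.lift_apply_of,
        FreeAbelianGroup.lift_apply_of, sub_eq_zero]
      exact mk_union d hd (F.push f hf he) (F₁.push f hf he) (F₂.push f hf he) hF hF₁ hF₂ ⟨i₁, i₂,
        ⟨h₁.1, h₁.2, h₁.3, h₁.4, fun x => congrArg f (h₁.5 x)⟩,
        ⟨h₂.1, h₂.2, h₂.3, h₂.4, fun x => congrArg f (h₂.5 x)⟩, h₃⟩)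

/-- The homomorphism `[φ : F → X] ↦ [F × N → Y, (x, y) ↦ f (φ x, y)]`. -/
def Bordism.cross (N : GMfd G n) (hN : N.NoBoundary)
    (f : X × N.carrier → Y) (hf : Continuous f)
    (he : ∀ g x y, f (ρ g x, N.act g y) = ρ' g (f (x, y))) (j j' : ℤ) (hj : j' = j + n) :
    Bordism ρ j →+ Bordism ρ' j' :=
  Bordism.hom (fun F => Bordism.mk ⟨F.dim + n, by have := F.dim_eq; push_cast; omega,
      F.sing.cross N hN rfl f hf he, OrMfd.prod_noBoundary F.closed hN rfl⟩) (by
    rintro _ (⟨d, hd, F, hF, W, ι, h₁, h₂, h₃⟩ | ⟨d, hd, F, F₁, F₂, hF, hF₁, hF₂, i₁, i₂, h₁, h₂, h₃⟩)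
    · rw [FreeAbelianGroup.lift_apply_of]
      refine mk_boundary _ _ _ _ (W.cross N hN (Nat.add_right_comm d n 1) f hf he) ⟨Prod.map ι id,
        h₁.prod N.toOrMfd hN rfl (Nat.add_right_comm d n 1), fun g x => Prod.ext (h₂ g x.1) rfl,
        fun x => ?_⟩
      exact congrArg (fun z => f (z, x.2)) (h₃ x.1)
    · rw [map_sub, map_add, FreeAbelianGroup.lift_apply_of, FreeAbelianGroup.lift_apply_of,
        FreeAbelianGroup.lift_apply_of, sub_eq_zero]
      refine mk_union _ _ _ _ _ _ _ _ ⟨Prod.map i₁ id, Prod.map i₂ id,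
        ⟨h₁.1.prodMap contMDiff_id, h₁.2.prodMap Function.injective_id,
          OrMfd.Preserves.prodMap hN hN rfl h₁.1 contMDiff_id h₁.3 N.preserves_id,
          fun g x => Prod.ext (h₁.4 g x.1) rfl,
          fun x => congrArg (fun z => f (z, x.2)) (h₁.5 x.1)⟩,
        ⟨h₂.1.prodMap contMDiff_id, h₂.2.prodMap Function.injective_id,
          OrMfd.Preserves.prodMap hN hN rfl h₂.1 contMDiff_id h₂.3 N.preserves_id,
          fun g x => Prod.ext (h₂.4 g x.1) rfl,
          fun x => congrArg (fun z => f (z, x.2)) (h₂.5 x.1)⟩, ?_⟩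
      rw [← compl_eq_iff_isCompl] at h₃ ⊢
      ext ⟨x, y⟩
      have hx := Set.ext_iff.1 h₃ x
      simp only [Set.mem_compl_iff, Set.mem_range] at hx ⊢
      constructor
      · intro hn
        obtain ⟨z, rfl⟩ := hx.1 (fun ⟨z, hz⟩ => hn ⟨(z, y), Prod.ext hz rfl⟩)
        exact ⟨(z, y), rfl⟩
      · rintro ⟨z, hz⟩ ⟨w, hw⟩
        exact hx.2 ⟨z.1, congrArg Prod.fst hz⟩ ⟨w.1, congrArg Prod.fst hw⟩)

end bordism

/-! ### The space of maps of garlands -/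

/-- The topology on `C^∞(M, M')` induced by the compact-open topology by means of
`f ↦ T^r f : T^r M → T^r M'`, the `r`-th iterated tangent map. -/
@[reducible]
def jetTopology : (r : ℕ) → {E E' H H' M M' : Type} →
    [NormedAddCommGroup E] → [NormedSpace ℝ E] → [NormedAddCommGroup E'] → [NormedSpace ℝ E'] →
    [TopologicalSpace H] → [TopologicalSpace H'] →
    (I : ModelWithCorners ℝ E H) → (I' : ModelWithCorners ℝ E' H') →
    [TopologicalSpace M] → [ChartedSpace H M] → [IsManifold I ∞ M] →
    [TopologicalSpace M'] → [ChartedSpace H' M'] → [IsManifold I' ∞ M'] →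
    TopologicalSpace C^∞⟮I, M; I', M'⟯
  | 0, _, _, _, _, M, M', _, _, _, _, _, _, _, _, _, _, _, _, _, _ =>
    .induced (fun f => (⟨f, f.contMDiff.continuous⟩ : C(M, M'))) inferInstance
  | r + 1, _, _, _, _, M, M', _, _, _, _, _, _, I, I', _, _, _, _, _, _ =>
    .induced (fun f => (⟨tangentMap I I' f, f.contMDiff.contMDiff_tangentMap le_rfl⟩ :
      C^∞⟮I.tangent, TangentBundle I M; I'.tangent, TangentBundle I' M'⟯))
      (jetTopology r I.tangent I'.tangent)

variable {n m : ℕ}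

/-- The set of smooth maps `P → M`. -/
def SmoothMap (P : OrMfd n) (M : OrMfd m) : Type := C^∞⟮P.I, P; M.I, M⟯

/-- The `C^∞`-topology: the coarsest one for which all `f ↦ T^r f` are continuous for the
compact-open topology. -/
instance (P : OrMfd n) (M : OrMfd m) : TopologicalSpace (SmoothMap P M) :=
  ⨅ r : ℕ, jetTopology r P.I M.I

instance (P : OrMfd n) (M : OrMfd m) : CoeFun (SmoothMap P M) (fun _ => P → M) :=
  ⟨fun f => DFunLike.coe (F := C^∞⟮P.I, P; M.I, M⟯) f⟩

/-- A graded mark on `N`: its grading (a positive integer), its number of points and the finite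
family of its points, possibly with repetitions. -/
def Mark (N : Type) : Type := ℕ+ × Σ s : ℕ, (Fin s → N)

namespace Mark

variable {N N' : Type}

instance [TopologicalSpace N] : TopologicalSpace (Mark N) :=
  inferInstanceAs (TopologicalSpace (ℕ+ × Σ s : ℕ, (Fin s → N)))

/-- The grading of a mark. -/
def grading (μ : Mark N) : ℕ+ := μ.1

/-- The number of elements of a mark. -/
def size (μ : Mark N) : ℕ := μ.2.1

/-- The points of a mark. -/
def point (μ : Mark N) (a : Fin μ.size) : N := μ.2.2 a

/-- Change the grading of a mark. -/
def regrade (f : ℕ+ → ℕ+) (μ : Mark N) : Mark N := (f μ.1, μ.2)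

/-- The image of a mark under a map. -/
def image (f : N → N') (μ : Mark N) : Mark N' := (μ.1, ⟨μ.2.1, f ∘ μ.2.2⟩)

/-- The mark `{x}` of grading one. -/
def singleton (x : N) : Mark N := (1, ⟨1, fun _ => x⟩)

/-- What `proj` does to the grading of a mark that it keeps: a grading other than one decreases by
one, and grading one becomes two. -/
def projGrading (g : ℕ+) : ℕ+ := if g = 1 then 2 else g - 1

/-- The marks that `proj` keeps: it erases the marks of grading one with at most one point. -/
def kept (μ : Mark N) : Bool := decide (μ.grading ≠ 1 ∨ 1 < μ.size)

section topology

variable [TopologicalSpace N]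

theorem continuous_regrade (f : ℕ+ → ℕ+) : Continuous (regrade f : Mark N → Mark N) :=
  (continuous_of_discreteTopology.comp continuous_fst).prodMk continuous_snd

theorem continuous_singleton : Continuous (singleton : N → Mark N) :=
  continuous_const.prodMk (continuous_sigmaMk.comp (continuous_pi fun _ => continuous_id))

theorem continuous_kept : Continuous (kept : Mark N → Bool) := by
  have h : Continuous (fun μ : Mark N => (μ.1, μ.2.1)) :=
    continuous_fst.prodMk
      ((continuous_sigma fun _ => continuous_const : Continuous
        (fun x : Σ s : ℕ, (Fin s → N) => x.1)).comp continuous_snd)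
  exact (continuous_of_discreteTopology
    (f := fun p : ℕ+ × ℕ => decide (p.1 ≠ 1 ∨ 1 < p.2))).comp h

end topology

end Mark

theorem continuous_listMap {A B : Type} [TopologicalSpace A] [TopologicalSpace B] {f : A → B}
    (hf : Continuous f) : Continuous (List.map f) := by
  rw [continuous_iff_continuousAt]
  intro l
  induction l with
  | nil => rw [ContinuousAt, nhds_nil]; exact Filter.tendsto_pure_left.2 fun s hs => mem_of_mem_nhds hs
  | cons a l ih =>
    rw [ContinuousAt, List.tendsto_cons_iff]
    exact (hf.continuousAt.tendsto.comp Filter.tendsto_fst).cons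
      (ih.tendsto.comp Filter.tendsto_snd)

theorem continuous_listFilter {A : Type} [TopologicalSpace A] {p : A → Bool}
    (hp : Continuous p) : Continuous (List.filter p) := by
  rw [continuous_iff_continuousAt]
  intro l
  induction l with
  | nil => rw [ContinuousAt, nhds_nil]; exact Filter.tendsto_pure_left.2 fun s hs => mem_of_mem_nhds hs
  | cons a l ih =>
    rw [ContinuousAt, List.tendsto_cons_iff]
    have h : ∀ᶠ x in 𝓝 a ×ˢ 𝓝 l, p x.1 = p a :=
      Filter.tendsto_fst.eventually
        (hp.continuousAt.eventually (show ∀ᶠ b in 𝓝 (p a), b = p a by simp [nhds_discrete]))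
    cases hpa : p a with
    | true =>
      rw [List.filter_cons_of_pos hpa]
      refine Filter.Tendsto.congr' ?_
        (Filter.tendsto_fst.cons (ih.tendsto.comp Filter.tendsto_snd))
      filter_upwards [h] with x hx
      rw [hpa] at hx
      simp [hx]
    | false =>
      rw [List.filter_cons_of_neg (by simp [hpa])]
      refine Filter.Tendsto.congr' ?_ (ih.tendsto.comp Filter.tendsto_snd)
      filter_upwards [h] with x hx
      rw [hpa] at hx
      simp [hx]

/-- The space of multimarked maps `(P₁ ⊔ ⋯ ⊔ P_k; μ₁, …, μ_l) → M`, for all numbers `l` of marks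
and all their gradings and sizes: a list of marks on `P₁ ⊔ ⋯ ⊔ P_k = Fin k × P` and `k` smooth maps
`P → M` that together are constant on every mark.  (The topology of the space of lists is that of
the disjoint union of the powers.)  The quotient of this space by the symmetric group `S_k` is the
part of `𝒩` that belongs to garlands with `k` components. -/
def GarlandMap (P : OrMfd n) (M : OrMfd m) (k : ℕ) : Type :=
  {x : List (Mark (Fin k × P)) × (Fin k → SmoothMap P M) //
    ∀ μ ∈ x.1, ∀ a b, x.2 (μ.point a).1 (μ.point a).2 = x.2 (μ.point b).1 (μ.point b).2}

namespace GarlandMap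

variable {P : OrMfd n} {M : OrMfd m} {k : ℕ}

instance : TopologicalSpace (GarlandMap P M k) := inferInstanceAs (TopologicalSpace (Subtype _))

/-- The point of `P₁ ⊔ ⋯ ⊔ P_k` that corresponds to `x` after a permutation of the copies. -/
def permute (σ : Equiv.Perm (Fin k)) (x : Fin k × P) : Fin k × P := (σ x.1, x.2)

/-- The action of the symmetric group: the copies of `P` are permuted, together with the marks. -/
instance : MulAction (Equiv.Perm (Fin k)) (GarlandMap P M k) where
  smul σ x := ⟨(x.1.1.map (Mark.image (permute σ)), fun j => x.1.2 (σ⁻¹ j)), by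
    intro μ hμ a b
    obtain ⟨μ', hμ', rfl⟩ := List.mem_map.1 hμ
    change x.1.2 (σ⁻¹ (σ (μ'.point a).1)) (μ'.point a).2 =
      x.1.2 (σ⁻¹ (σ (μ'.point b).1)) (μ'.point b).2
    have hσ : ∀ j, σ⁻¹ (σ j) = j := σ.symm_apply_apply
    rw [hσ, hσ]
    exact x.2 μ' hμ' a b⟩
  one_smul x := Subtype.ext (Prod.ext (List.map_id _) rfl)
  mul_smul σ τ x := Subtype.ext (Prod.ext (by
    change List.map _ _ = List.map _ (List.map _ _)
    rw [List.map_map]; rfl) (by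
    funext j
    change x.1.2 ((σ * τ)⁻¹ j) = x.1.2 (τ⁻¹ (σ⁻¹ j))
    rw [mul_inv_rev]; rfl))

/-- Add the mark `{y}` of grading one, and increase the gradings of all other marks by one. -/
def addMark (x : GarlandMap P M k × (Fin k × P)) : GarlandMap P M k :=
  ⟨(Mark.singleton x.2 :: x.1.1.1.map (Mark.regrade (· + 1)), x.1.1.2), by
    intro μ hμ a b
    rcases List.mem_cons.1 hμ with rfl | hμ
    · rfl
    · obtain ⟨μ', hμ', rfl⟩ := List.mem_map.1 hμ
      exact x.1.2 μ' hμ' a b⟩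

theorem continuous_addMark : Continuous (addMark (P := P) (M := M) (k := k)) := by
  refine Continuous.subtype_mk (Continuous.prodMk ?_ ?_) _
  · exact List.continuous_cons.comp ((Mark.continuous_singleton.comp continuous_snd).prodMk
      ((continuous_listMap (Mark.continuous_regrade _)).comp
        (continuous_fst.comp (continuous_subtype_val.comp continuous_fst))))
  · exact continuous_snd.comp (continuous_subtype_val.comp continuous_fst)

theorem addMark_smul (σ : Equiv.Perm (Fin k)) (x : GarlandMap P M k) (y : Fin k × P) :
    addMark (σ • x, permute σ y) = σ • addMark (x, y) :=
  Subtype.ext (Prod.ext (congrArg₂ List.cons rfl (by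
    change List.map _ (List.map _ _) = List.map _ (List.map _ _)
    rw [List.map_map, List.map_map]; rfl)) rfl)

/-- Marks of grading other than one decrease their grading by one; marks of grading one with more
than one point get grading two; marks of grading one with at most one point are erased. -/
def changeMarks (x : GarlandMap P M k) : GarlandMap P M k :=
  ⟨((x.1.1.filter Mark.kept).map (Mark.regrade Mark.projGrading), x.1.2), by
    intro μ hμ a b
    obtain ⟨μ', hμ', rfl⟩ := List.mem_map.1 hμ
    exact x.2 μ' (List.mem_of_mem_filter hμ') a b⟩

theorem continuous_changeMarks : Continuous (changeMarks (P := P) (M := M) (k := k)) := by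
  refine Continuous.subtype_mk (Continuous.prodMk ?_ ?_) _
  · exact (continuous_listMap (Mark.continuous_regrade _)).comp
      ((continuous_listFilter Mark.continuous_kept).comp
        (continuous_fst.comp continuous_subtype_val))
  · exact continuous_snd.comp continuous_subtype_val

theorem changeMarks_smul (σ : Equiv.Perm (Fin k)) (x : GarlandMap P M k) :
    changeMarks (σ • x) = σ • changeMarks x :=
  Subtype.ext (Prod.ext (by
    change List.map _ (List.filter _ (List.map _ _)) = List.map _ (List.map _ (List.filter _ _))
    rw [List.filter_map, List.map_map, List.map_map]; rfl) rfl)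

end GarlandMap

/-! ### The bordism groups of `𝒩` and the homomorphisms `lift`, `proj` and `Δ` -/

/-- The closed oriented manifold `P₁ ⊔ ⋯ ⊔ P_k` with the action of the symmetric group that
permutes the copies. -/
def copiesG (k : ℕ) (P : OrMfd n) [CompactSpace P] (hP : P.NoBoundary) :
    GMfd (Equiv.Perm (Fin k)) n where
  toOrMfd := P.copies k hP
  compact := inferInstanceAs (CompactSpace (Fin k × P))
  act :=
    { toFun := fun σ => Equiv.prodCongr σ (Equiv.refl P)
      map_one' := rfl
      map_mul' := fun _ _ => rfl }
  smooth σ := (OrMfd.points_smooth (k := k) σ).prodMap contMDiff_id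
  preserves σ := OrMfd.Preserves.prodMap hP hP _ (OrMfd.points_smooth (k := k) σ) contMDiff_id
    (OrMfd.points_preserves (k := k) σ) P.preserves_id

/-- `P` with the action of the trivial group. -/
def trivialG (P : OrMfd n) [CompactSpace P] : GMfd (Equiv.Perm (Fin 0)) n where
  toOrMfd := P
  compact := inferInstance
  act := 1
  smooth _ := contMDiff_id
  preserves _ := P.preserves_id

/-- The oriented bordism group `Ω_j(𝒩)`, where `𝒩` is the disjoint union of `M = 𝒩(0; 0)` and of
the quotients of the spaces `GarlandMap P M k` by the symmetric groups `S_k`, for `k ≥ 1`; the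
quotients are taken together with the adjoint maps (see `SingMfd`). -/
def Omega (P : OrMfd n) (M : OrMfd m) (j : ℤ) : Type 1 :=
  Bordism (1 : Equiv.Perm (Fin 0) →* Equiv.Perm M) j ×
    DirectSum ℕ fun k =>
      Bordism (MulAction.toPermHom (Equiv.Perm (Fin (k + 1))) (GarlandMap P M (k + 1))) j

instance (P : OrMfd n) (M : OrMfd m) (j : ℤ) : AddCommGroup (Omega P M j) :=
  inferInstanceAs (AddCommGroup (_ × DirectSum ℕ fun k =>
    Bordism (MulAction.toPermHom (Equiv.Perm (Fin (k + 1))) (GarlandMap P M (k + 1))) j))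

/-- The shifted bordism group `𝕆_i(𝒩) = Ω_{i + dim M}(𝒩)`. -/
abbrev ShiftedOmega (P : OrMfd n) (M : OrMfd m) (i : ℤ) : Type 1 := Omega P M (i + m)

/-- The homomorphism `lift : 𝕆_i(𝒩) → 𝕆_{i+n}(𝒩)`, `[φ : F → 𝒩] ↦ [ψ : F × N → 𝒩]`: here `N` is
`P₁ ⊔ ⋯ ⊔ P_k`, and `ψ (f, y)` is `φ f` with the additional mark `{y}` of grading one, all other
gradings being increased by one.  On singular manifolds `F → M` it is `[φ] ↦ [φ ∘ pr : F × P → M]`.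
-/
def lift (P : OrMfd n) [CompactSpace P] (hP : P.NoBoundary) (M : OrMfd m) (i : ℤ) :
    ShiftedOmega P M i →+ ShiftedOmega P M (i + n) :=
  AddMonoidHom.prodMap
    (Bordism.cross (trivialG P) hP Prod.fst continuous_fst (fun _ _ _ => rfl) (i + m) (i + n + m)
      (add_right_comm i n m))
    (DirectSum.map fun k =>
      Bordism.cross (copiesG (k + 1) P hP) (OrMfd.prod_noBoundary (OrMfd.points_noBoundary (k + 1)) hP _) GarlandMap.addMark
        GarlandMap.continuous_addMark GarlandMap.addMark_smul (i + m) (i + n + m)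
        (add_right_comm i n m))

/-- The homomorphism `proj : 𝕆_i(𝒩) → 𝕆_i(𝒩)`, which changes the marks only. -/
def proj (P : OrMfd n) (M : OrMfd m) (i : ℤ) : ShiftedOmega P M i →+ ShiftedOmega P M i :=
  AddMonoidHom.prodMap (AddMonoidHom.id _)
    (DirectSum.map fun _ =>
      Bordism.push GarlandMap.changeMarks GarlandMap.continuous_changeMarks
        GarlandMap.changeMarks_smul (i + m))

/-- The homomorphism `Δ = lift ∘ proj : 𝕆_i(𝒩) → 𝕆_{i+n}(𝒩)`. -/
def Delta (P : OrMfd n) [CompactSpace P] (hP : P.NoBoundary) (M : OrMfd m) (i : ℤ) :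
    ShiftedOmega P M i →+ ShiftedOmega P M (i + n) :=
  (lift P hP M i).comp (proj P M i)

end Garland

end

/-! Since `Δ² = lift ∘ (proj ∘ lift) ∘ proj`, it suffices that `proj ∘ lift = 0` (`proj_comp_lift`).

On spaces of multimarked maps, `changeMarks` undoes `addMark` (`GarlandMap.changeMarks_addMark`).
After a lift the new mark is the only one of grading one; it has a single point and is erased, and
all other gradings return to their old values. Hence `proj ∘ lift` sends `φ : Q → X_k` to `φ ∘ pr₁ :
Q × N_k → X_k`. On `Ω(M)`, where `proj` is the identity, the lift is already of the form `φ ∘ pr₁ :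
F × P → M`.

If `P = ∂W`, then `N_k` is the boundary of `k` copies of `W`, equivariantly for the permutations of
the copies. So `Q × N_k` bounds the product of `Q` with these copies. The map `φ ∘ pr₁` does not
involve the second factor and extends; the diagonal action stays free because it is free on `Q`
(`Bordism.cross_fst_eq_zero`).

The remaining work concerns orientations. A product may have boundary only in its left factor, so
the filling is written `W × Q` and its boundary is identified with `Q × N` by exchanging the
factors. The exchange changes orientations by a constant sign, which is absorbed into the
orientation of the filling. -/

open scoped Manifold ContDiff Topology

noncomputable section

namespace Garland

/-! ### Orientation signs, boundary maps and the exchange of factors -/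

namespace OrMfd

variable {d n e : ℕ}

/-- The manifold with its orientation multiplied by a constant sign. -/
def twist (F : OrMfd d) (s : ℤˣ) : OrMfd d where
  E := F.E
  H := F.H
  carrier := F
  I := F.I
  lin := F.lin
  range_I := F.range_I
  basis := F.basis
  sign x := s * F.sign x
  sign_consistent x := by
    filter_upwards [F.sign_consistent x] with y hy
    rwa [mul_mul_mul_comm, Int.units_mul_self, one_mul]

/-- `f` multiplies the orientations by the constant sign `s`. -/
def PreservesUpTo (s : ℤˣ) (F F' : OrMfd d) (f : F → F') : Prop :=
  ∀ x, 0 < ((s * (F.sign x * F'.sign (f x)) : ℤˣ) : ℝ) *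
    F'.basis.det (fun i => F.deriv F' f x (F.basis i))

theorem Preserves.twist {F F' : OrMfd d} {f : F → F'} (h : F.Preserves F' f) (s : ℤˣ) :
    (F.twist s).Preserves (F'.twist s) f := by
  intro x
  change 0 < (((s * F.sign x) * (s * F'.sign (f x)) : ℤˣ) : ℝ) *
    F'.basis.det (fun i => F.deriv F' f x (F.basis i))
  rw [mul_mul_mul_comm, Int.units_mul_self, one_mul]
  exact h x

/-- The determinant of `ν` followed by the image of a frame, as a function of the frame. -/
theorem det_cons_comp {E E' : Type*} [AddCommGroup E] [AddCommGroup E'] [Module ℝ E] [Module ℝ E']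
    (b : Module.Basis (Fin d) ℝ E) (c : Module.Basis (Fin (d + 1)) ℝ E') (ν : E') (A : E →ₗ[ℝ] E')
    (v : Fin d → E) :
    c.det (Fin.cons ν (fun i => A (v i)) : Fin (d + 1) → E') =
      c.det (Fin.cons ν (fun i => A (b i)) : Fin (d + 1) → E') * b.det v :=
  -- As a function of `v` the left side is an alternating `d`-form on a `d`-dimensional space, hence
  -- the multiple of `b.det` given by its value on `b`.
  DFunLike.congr_fun (((c.det.curryLeft ν).compLinearMap A).eq_smul_basis_det b) v

/-- A boundary map, composed with a diffeomorphism that multiplies orientations by `s`. -/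
theorem IsBoundaryMap.comp {F F' : OrMfd d} {W : OrMfd (d + 1)} {ι : F → W}
    (hι : F.IsBoundaryMap W ι) {s : ℤˣ} {h : F' → F} (hh : ContMDiff F'.I F.I ∞ h)
    (hb : Function.Bijective h) (hs : PreservesUpTo s F' F h) :
    F'.IsBoundaryMap (W.twist s) (ι ∘ h) where
  smooth := hι.smooth.comp hh
  injective := hι.injective.comp hb.injective
  range_eq := (hb.surjective.range_comp ι).trans hι.range_eq
  oriented x ν hν := by
    have hd : F'.deriv W (ι ∘ h) x = (F.deriv W ι (h x)).comp (F'.deriv F h x) :=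
      mfderiv_comp x ((hι.smooth (h x)).mdifferentiableAt (by simp))
        ((hh x).mdifferentiableAt (by simp))
    change 0 < ((F'.sign x * (s * W.sign (ι (h x))) : ℤˣ) : ℝ) *
      W.basis.det (Fin.cons ν (fun i => F'.deriv W (ι ∘ h) x (F'.basis i)) : Fin (d + 1) → W.E)
    rw [hd]
    have key := det_cons_comp F.basis W.basis ν (F.deriv W ι (h x)).toLinearMap
      (fun i => F'.deriv F h x (F'.basis i))
    simp only [ContinuousLinearMap.coe_coe] at key
    simp only [ContinuousLinearMap.comp_apply]
    rw [key]
    have := mul_pos (hι.oriented (h x) ν hν) (hs x)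
    -- Inserting the square of the sign at the intermediate point `h x` splits the total sign into
    -- one for `ι` at `h x` and one for `h` at `x`, matching the two determinants in `key`.
    have hu : F'.sign x * (s * W.sign (ι (h x))) =
        (F.sign (h x) * W.sign (ι (h x))) * (s * (F'.sign x * F.sign (h x))) := by
      have := Int.units_mul_self (F.sign (h x))
      calc _ = F'.sign x * (s * W.sign (ι (h x))) * (F.sign (h x) * F.sign (h x)) := by
            rw [this, mul_one]
        _ = _ := by ac_rfl
    rw [hu, Units.val_mul, Int.cast_mul]
    linarith

section swap

variable {E E' H H' M M' : Type*} [NormedAddCommGroup E] [NormedSpace ℝ E]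
  [NormedAddCommGroup E'] [NormedSpace ℝ E'] [TopologicalSpace H] [TopologicalSpace H']
  (I : ModelWithCorners ℝ E H) (I' : ModelWithCorners ℝ E' H')
  [TopologicalSpace M] [TopologicalSpace M'] [ChartedSpace H M] [ChartedSpace H' M']

theorem contMDiff_swap : ContMDiff (I.prod I') (I'.prod I) ∞ (Prod.swap : M × M' → M' × M) :=
  contMDiff_snd.prodMk contMDiff_fst

/-- The derivative does not depend on `x`; this is what makes the orientation sign of the exchange
constant. -/
theorem mfderiv_swap (x : M × M') : mfderiv (I.prod I') (I'.prod I) Prod.swap x =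
    (ContinuousLinearMap.snd ℝ E E').prod (ContinuousLinearMap.fst ℝ E E') :=
  (mfderiv_prodMk (x := x) mdifferentiableAt_snd mdifferentiableAt_fst).trans
    (congrArg₂ ContinuousLinearMap.prod mfderiv_snd mfderiv_fst)

end swap

theorem exists_sign_mul_pos {r : ℝ} (hr : r ≠ 0) : ∃ s : ℤˣ, 0 < ((s : ℤ) : ℝ) * r := by
  rcases hr.lt_or_gt with h | h
  · exact ⟨-1, by simpa using h⟩
  · exact ⟨1, by simpa using h⟩

/-- Exchanging the factors of a product multiplies the orientation by a constant sign. -/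
theorem exists_preservesUpTo_swap (F : OrMfd d) (N : OrMfd n) (hF : F.NoBoundary)
    (hN : N.NoBoundary) (h : e = d + n) (h' : e = n + d) :
    ∃ s : ℤˣ, PreservesUpTo s (F.prod N hN h) (N.prod F hF h') Prod.swap := by
  -- The image of the product frame under the linear exchange. Its determinant in the opposite
  -- product basis is a nonzero constant, so its sign serves as `s`. The value is `(-1)^(d * n)`,
  -- but only existence is needed.
  let b : Module.Basis (Fin e) ℝ (N.E × F.E) :=
    (prodBasis h F.basis N.basis).map (LinearEquiv.prodComm ℝ F.E N.E)
  obtain ⟨s, hs⟩ := exists_sign_mul_pos ((prodBasis h' N.basis F.basis).isUnit_det b).ne_zero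
  refine ⟨s, fun x => ?_⟩
  have hd : (F.prod N hN h).deriv (N.prod F hF h') Prod.swap x =
      (ContinuousLinearMap.snd ℝ F.E N.E).prod (ContinuousLinearMap.fst ℝ F.E N.E) :=
    mfderiv_swap F.I N.I x
  change 0 < ((s * ((F.sign x.1 * N.sign x.2) * (N.sign x.2 * F.sign x.1)) : ℤˣ) : ℝ) *
      (prodBasis h' N.basis F.basis).det
        (fun i => (F.prod N hN h).deriv (N.prod F hF h') Prod.swap x
          (prodBasis h F.basis N.basis i))
  -- The pointwise signs of `F` and `N` each occur twice and cancel, leaving only `s`.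
  rw [mul_comm (N.sign x.2), Int.units_mul_self, mul_one]
  have hb : (fun i => (F.prod N hN h).deriv (N.prod F hF h') Prod.swap x
      (prodBasis h F.basis N.basis i)) = b := by
    funext i
    refine (DFunLike.congr_fun hd _).trans ?_
    simp only [b, Module.Basis.map_apply]
    rfl
  exact lt_of_lt_of_eq hs (congrArg (fun v => (s : ℝ) * (prodBasis h' N.basis F.basis).det v) hb.symm)

/-- If `N` bounds `W` then `F × N` bounds `W × F`, with a suitable orientation. -/
theorem IsBoundaryMap.exists_prod_left {N : OrMfd n} {W : OrMfd (n + 1)} {ι : N → W}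
    (hι : N.IsBoundaryMap W ι) (hN : N.NoBoundary) (F : OrMfd d) (hF : F.NoBoundary)
    (h : e = d + n) (h' : e + 1 = (n + 1) + d) :
    ∃ s : ℤˣ, (F.prod N hN h).IsBoundaryMap ((W.prod F hF h').twist s)
      (Prod.map ι id ∘ Prod.swap) := by
  have h'' : e = n + d := h.trans (add_comm d n)
  -- The factor `W` must stand on the left, because the right factor of `OrMfd.prod` has no
  -- boundary.
  obtain ⟨s, hs⟩ := exists_preservesUpTo_swap F N hF hN h h''
  exact ⟨s, (hι.prod F hF h'' h').comp (contMDiff_swap F.I N.I) Prod.swap_bijective hs⟩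

end OrMfd

/-! ### Products with an equivariant boundary are null-bordant -/

namespace GMfd

variable {G : Type} [Group G] {d n : ℕ}

/-- `N` is the oriented boundary of `W`, equivariantly. -/
def IsBoundaryOf (N : GMfd G n) (W : GMfd G (n + 1)) : Prop :=
  ∃ ι : N.carrier → W.carrier, N.toOrMfd.IsBoundaryMap W.toOrMfd ι ∧
    ∀ g x, ι (N.act g x) = W.act g (ι x)

end GMfd

namespace SingMfd

variable {G : Type} [Group G] {X : Type} [TopologicalSpace X] {ρ : G →* Equiv.Perm X}
  {d n e : ℕ}

/-- The product `W × F`, with its orientation multiplied by `s`, mapped by means of `F → X`. -/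
def crossLeft (F : SingMfd ρ d) (hF : F.NoBoundary) (W : GMfd G n) (h : e = n + d) (s : ℤˣ) :
    SingMfd ρ e where
  toOrMfd := (W.toOrMfd.prod F.toOrMfd hF h).twist s
  compact := by
    have := F.compact
    have := W.compact
    exact inferInstanceAs (CompactSpace (W.carrier × F.carrier))
  act :=
    { toFun := fun g => (W.act g).prodCongr (F.act g)
      map_one' := by rw [map_one, map_one]; rfl
      map_mul' := fun g g' => by rw [map_mul, map_mul]; rfl }
  smooth g := (W.smooth g).prodMap (F.smooth g)
  preserves g := (OrMfd.Preserves.prodMap hF hF h (W.smooth g) (F.smooth g) (W.preserves g)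
    (F.preserves g)).twist s
  free g x hx := F.free g x.2 (congrArg Prod.snd hx)
  map x := F.map x.2
  continuous_map := F.continuous_map.comp continuous_snd
  equivariant g x := F.equivariant g x.2

end SingMfd

section bordism

variable {G : Type} [Group G] {X Y : Type} [TopologicalSpace X] [TopologicalSpace Y]
  {ρ : G →* Equiv.Perm X} {ρ' : G →* Equiv.Perm Y} {n : ℕ}

theorem Bordism.hom_ext {j : ℤ} {A : Type*} [AddCommGroup A] {f g : Bordism ρ j →+ A}
    (h : ∀ F, f (Bordism.mk F) = g (Bordism.mk F)) : f = g :=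
  QuotientAddGroup.addMonoidHom_ext _ (FreeAbelianGroup.lift_ext _ _ h)

/-- The product with a `G`-manifold that bounds, followed by the projection to the first factor,
is null-bordant. -/
theorem Bordism.cross_fst_eq_zero {N : GMfd G n} (hN : N.NoBoundary) {W : GMfd G (n + 1)}
    (hW : N.IsBoundaryOf W) (j j' : ℤ) (hj : j' = j + n) :
    Bordism.cross (ρ := ρ) (ρ' := ρ) N hN Prod.fst continuous_fst (fun _ _ _ => rfl) j j' hj = 0 := by
  obtain ⟨ι, hι, he⟩ := hW
  refine Bordism.hom_ext fun F => ?_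
  -- The null-bordism is `W × F` with the action of `G` on both factors, mapped through `F` alone.
  -- The action on `W` need not be free.
  obtain ⟨s, hs⟩ := hι.exists_prod_left hN F.sing.toOrMfd F.closed rfl
    (show F.dim + n + 1 = (n + 1) + F.dim by omega)
  exact Bordism.mk_boundary (F.dim + n) _ _ _ (F.sing.crossLeft F.closed W
    (show F.dim + n + 1 = (n + 1) + F.dim by omega) s)
    ⟨_, hs, fun g x => Prod.ext (he g x.2) rfl, fun _ => rfl⟩

/-- The product with a `G`-manifold that bounds is annihilated by every map that forgets the second
factor. -/
theorem Bordism.push_comp_cross_eq_zero {N : GMfd G n} (hN : N.NoBoundary) {W : GMfd G (n + 1)}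
    (hW : N.IsBoundaryOf W) {f : X × N.carrier → Y} (hf : Continuous f)
    (he : ∀ g x y, f (ρ g x, N.act g y) = ρ' g (f (x, y))) {k : Y → X} (hk : Continuous k)
    (hke : ∀ g x, k (ρ' g x) = ρ g (k x)) (hkf : ∀ z, k (f z) = z.1) (j j' : ℤ)
    (hj : j' = j + n) :
    (Bordism.push k hk hke j').comp (Bordism.cross N hN f hf he j j' hj) = 0 := by
  have h : (Bordism.push k hk hke j').comp (Bordism.cross N hN f hf he j j' hj) =
      Bordism.cross N hN (k ∘ f) (hk.comp hf)
        (fun g x y => (congrArg k (he g x y)).trans (hke g _)) j j' hj :=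
    -- On a representative both sides are the same manifold `F × N` with the same map, by
    -- definition.
    Bordism.hom_ext fun _ => rfl
  rw [h, ← Bordism.cross_fst_eq_zero hN hW j j' hj]
  congr 1
  exact funext hkf

end bordism

/-! ### Cancellation of the marks -/

/-- A raised grading is at least two, so the exceptional value of `projGrading` at one is never
reached. -/
theorem Mark.projGrading_add_one (g : ℕ+) : Mark.projGrading (g + 1) = g := by
  have h : g + 1 ≠ 1 := (PNat.lt_add_left 1 g).ne'
  rw [Mark.projGrading, if_neg h, PNat.add_sub]

theorem Mark.kept_regrade_add_one {N : Type} (μ : Mark N) : (μ.regrade (· + 1)).kept = true :=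
  decide_eq_true (Or.inl (PNat.lt_add_left 1 μ.grading).ne')

variable {n m : ℕ}

/-- Changing the marks after the addition of a mark forgets the mark that was added. -/
theorem GarlandMap.changeMarks_addMark {P : OrMfd n} {M : OrMfd m} {k : ℕ}
    (x : GarlandMap P M k × (Fin k × P)) : (addMark x).changeMarks = x.1 := by
  refine Subtype.ext (Prod.ext ?_ rfl)
  change List.map _ (List.filter _ (Mark.singleton x.2 :: List.map _ _)) = x.1.1.1
  have h : ∀ l : List (Mark (Fin k × P)), ∀ μ ∈ l.map (Mark.regrade (· + 1)), μ.kept = true := by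
    intro l μ hμ
    obtain ⟨μ, -, rfl⟩ := List.mem_map.1 hμ
    exact μ.kept_regrade_add_one
  -- The added mark fails both conditions for being kept. A mark that would have been erased before
  -- the lift, having grading one and at most one point, is now protected by its grading two.
  rw [List.filter_cons_of_neg (by simp [Mark.kept, Mark.singleton, Mark.grading, Mark.size]),
    List.filter_eq_self.2 (h _), List.map_map]
  have h' : (Mark.regrade Mark.projGrading ∘ Mark.regrade (· + 1) :
      Mark (Fin k × P) → Mark (Fin k × P)) = id :=
    funext fun μ => Prod.ext (Mark.projGrading_add_one μ.1) rfl
  rw [h', List.map_id]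

/-! ### Fillings of the copies of `P` -/

/-- The copies of a compact manifold `W` with boundary, permuted by the symmetric group. -/
def fillingG (k : ℕ) (W : OrMfd n) [CompactSpace W] (s : ℤˣ) : GMfd (Equiv.Perm (Fin k)) n where
  toOrMfd := (W.prod (OrMfd.points k) (OrMfd.points_noBoundary k) rfl).twist s
  compact := inferInstanceAs (CompactSpace (W × Fin k))
  act :=
    { toFun := fun σ => Equiv.prodCongr (Equiv.refl W) σ
      map_one' := rfl
      map_mul' := fun _ _ => rfl }
  smooth σ := contMDiff_id.prodMap (OrMfd.points_smooth (k := k) σ)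
  preserves σ := (OrMfd.Preserves.prodMap (OrMfd.points_noBoundary k) (OrMfd.points_noBoundary k) _
    contMDiff_id (OrMfd.points_smooth (k := k) σ) W.preserves_id
    (OrMfd.points_preserves (k := k) σ)).twist s

theorem OrMfd.Bounds.exists_copiesG {P : OrMfd n} [CompactSpace P] (hP : P.NoBoundary)
    (hbd : P.Bounds) (k : ℕ) : ∃ W, (copiesG k P hP).IsBoundaryOf W := by
  obtain ⟨W, _, ι, hι⟩ := hbd
  -- `N_k` is itself a product, with the `0`-manifold of `k` points as the closed factor.
  -- Permutations act on that factor only, so the boundary map is equivariant by definition.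
  obtain ⟨s, hs⟩ := hι.exists_prod_left hP (OrMfd.points k) (OrMfd.points_noBoundary k)
    (zero_add n).symm rfl
  exact ⟨fillingG k W s, _, hs, fun _ _ => rfl⟩

/-- The case needed for the summand `Ω(M)`, whose symmetry group is trivial. -/
theorem OrMfd.Bounds.exists_trivialG {P : OrMfd n} [CompactSpace P] (hbd : P.Bounds) :
    ∃ W, (trivialG P).IsBoundaryOf W := by
  obtain ⟨W, hW, ι, hι⟩ := hbd
  exact ⟨⟨W, hW, 1, fun _ => contMDiff_id, fun _ => W.preserves_id⟩, ι, hι, fun _ _ => rfl⟩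

/-! ### Vanishing of `proj ∘ lift` and of `Δ²` -/

/-- If `P` bounds, then `proj ∘ lift = 0`. -/
theorem proj_comp_lift (P : OrMfd n) [CompactSpace P] (hP : P.NoBoundary) (M : OrMfd m)
    (hbd : P.Bounds) (i : ℤ) : (proj P M (i + n)).comp (lift P hP M i) = 0 := by
  obtain ⟨W, hW⟩ := hbd.exists_trivialG
  -- On `Ω(M)` nothing has to be forgotten by `proj`: the lift is already the product with `P`
  -- followed by the first projection.
  have h₁ := Bordism.cross_fst_eq_zero (ρ := (1 : Equiv.Perm (Fin 0) →* Equiv.Perm M))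
    (N := trivialG P) hP hW (i + m) (i + n + m) (add_right_comm i n m)
  have h₂ : ∀ k : ℕ, (Bordism.push
      (ρ := MulAction.toPermHom (Equiv.Perm (Fin (k + 1))) (GarlandMap P M (k + 1)))
      (ρ' := MulAction.toPermHom (Equiv.Perm (Fin (k + 1))) (GarlandMap P M (k + 1)))
      GarlandMap.changeMarks GarlandMap.continuous_changeMarks
      GarlandMap.changeMarks_smul (i + n + m)).comp
      (Bordism.cross
        (ρ := MulAction.toPermHom (Equiv.Perm (Fin (k + 1))) (GarlandMap P M (k + 1)))
        (copiesG (k + 1) P hP) (OrMfd.prod_noBoundary (OrMfd.points_noBoundary (k + 1)) hP _)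
        (GarlandMap.addMark (M := M)) GarlandMap.continuous_addMark GarlandMap.addMark_smul (i + m)
        (i + n + m) (add_right_comm i n m)) = 0 := by
    intro k
    obtain ⟨W', hW'⟩ := hbd.exists_copiesG hP (k + 1)
    exact Bordism.push_comp_cross_eq_zero _ hW' _ _ _ _ GarlandMap.changeMarks_addMark _ _ _
  ext x : 1
  -- Both `lift` and `proj` respect the decomposition of `Ω(𝒩)`, so the composite is tested on each
  -- summand.
  refine Prod.ext (DFunLike.congr_fun h₁ x.1) (DirectSum.ext_component ℤ fun k => ?_)
  exact DFunLike.congr_fun (h₂ k) (x.2 k)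

end Garland

end

theorem corollary4p5 {n m : ℕ} (P : Garland.OrMfd n) [CompactSpace P] [ConnectedSpace P]
    (hP : P.NoBoundary) (M : Garland.OrMfd m) [ConnectedSpace M] (hM : M.NoBoundary)
    (hbd : P.Bounds) (i : ℤ) :
    (Garland.Delta P hP M (i + n)).comp (Garland.Delta P hP M i) = 0 := by
  refine AddMonoidHom.ext fun x => ?_
  -- The four factors of `Δ²` are regrouped: the inner `proj ∘ lift` is applied to the class `proj
  -- x`.
  have h := DFunLike.congr_fun (Garland.proj_comp_lift P hP M hbd i) (Garland.proj P M i x)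
  exact (congrArg (Garland.lift P hP M (i + n)) h).trans (map_zero _)
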